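/- Let $d \ge 2$ and $0 \le k < d$ be integers. The following are equivalent: (i) $k \ge \frac{d}{2}$; (ii) there exists a $(2,k,d)$-set, that is, a compact set $K \subseteq [0,1]^d$ such that $K$ intersects each $k$-dimensional affine subspace of $\mathbb{R}^d$ that meets $[0,1]^d$, but the Minkowski sumset $K + K = \{x + y : x, y \in K\}$ is nowhere dense in $\mathbb{R}^d$. -/

import Mathlib

open scoped Pointwise

/-- The closed unit cube `[0,1]^d` in Euclidean space `ℝ^d`. -/
def unitCube (d : ℕ) : Set (EuclideanSpace ℝ (Fin d)) :=
  {x | ∀ i, 0 ≤ x i ∧ x i ≤ 1}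

/-- `K` is a `(2,k,d)`-set: a compact subset of the unit cube `[0,1]^d` that intersects each
`k`-dimensional affine subspace of `ℝ^d` meeting the cube, and whose Minkowski sumset `K + K`
is nowhere dense in `ℝ^d`. -/
structure IsTwoSet (k d : ℕ) (K : Set (EuclideanSpace ℝ (Fin d))) : Prop where
  isCompact : IsCompact K
  subset_unitCube : K ⊆ unitCube d
  meets_affineSubspace : ∀ V : AffineSubspace ℝ (EuclideanSpace ℝ (Fin d)),
    Module.finrank ℝ V.direction = k →
      ((V : Set (EuclideanSpace ℝ (Fin d))) ∩ unitCube d).Nonempty →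
        ((V : Set (EuclideanSpace ℝ (Fin d))) ∩ K).Nonempty
  isNowhereDense_add : IsNowhereDense (K + K)

/-! The condition says `d ≤ 2 * k`. For sufficiency, look for a continuous `F` on ℝ^d, periodic
under ℤ^d and odd under x ↦ (1/2, ..., 1/2) - x, with `F ≥ 1/2` somewhere on the cube part of every
k-flat meeting the cube (`exists_odd_periodic_large_on_flats`). For a large integer N, let K be the
set of cube points x with F(N^j x) ≥ 1/4 for all j. Self-similarity lets K meet every such flat. If
x, y ∈ K, no N^n (x + y) has all coordinates in 1/2 + ℤ: otherwise F(N^n y) = -F(N^n x). As n grows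
the excluded points become dense, so the compact set K + K has empty interior.

A flat has a cube point with k coordinates in {0, 1}, where ∑ cos(2π x_i) ≥ 2k - d. This suffices
when d < 2k. When d = 2k the bound is only 0, and a rapidly oscillating wave is added whose phase is
constant on no segment.

For necessity, let 2k < d. Then K contains a k-dimensional face of the cube and projects onto the
complementary coordinate cube. By Baire's theorem, the sum of that face and a suitable part of K
already has interior. -/

/-! ### Nonconstancy of weighted cosine sums. -/

open Real in
theorem exists_sum_erase_two_pow_lt {d : ℕ} (s : Finset (Fin d)) (hs : s.Nonempty) :
    ∃ i ∈ s, ∑ j ∈ s.erase i, (2 : ℝ) ^ (j : ℕ) < 2 ^ (i : ℕ) := by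
  refine ⟨s.max' hs, s.max'_mem hs, ?_⟩
  have h := Nat.geomSum_lt (m := 2) (n := (s.max' hs : ℕ))
    (s := (s.erase (s.max' hs)).map Fin.valEmbedding) le_rfl (by
      intro k hk
      obtain ⟨j, hj, rfl⟩ := Finset.mem_map.1 hk
      exact Finset.lt_max'_of_mem_erase_max' s hs hj)
  rw [Finset.sum_map] at h
  exact_mod_cast h

open Real Filter Topology in
/-- A sum of cosine waves whose weights are distinct powers of two is not constant, unless all
frequencies vanish. -/
theorem sum_two_pow_mul_cos_not_const {d : ℕ} (q v : Fin d → ℝ) (hv : v ≠ 0) (C : ℝ)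
    (h : ∀ t ∈ Set.Ioo (0 : ℝ) 1, ∑ i : Fin d, (2 : ℝ) ^ (i : ℕ) * cos (q i + v i * t) = C) : False := by
  have hder : ∀ n : ℕ, ∀ t ∈ Set.Ioo (0 : ℝ) 1,
      ∑ i : Fin d, (2 : ℝ) ^ (i : ℕ) * (v i ^ (n + 1) * cos (q i + v i * t + (n + 1) * (π / 2))) = 0 := by
    have key : ∀ (n : ℕ) (t : ℝ), HasDerivAt
        (fun t => ∑ i : Fin d, (2 : ℝ) ^ (i : ℕ) * (v i ^ n * cos (q i + v i * t + n * (π / 2))))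
        (∑ i : Fin d, (2 : ℝ) ^ (i : ℕ) * (v i ^ (n + 1) * cos (q i + v i * t + (n + 1) * (π / 2)))) t := by
      intro n t
      refine HasDerivAt.fun_sum fun i _ => HasDerivAt.const_mul _ ?_
      have h1 : HasDerivAt (fun t => q i + v i * t + n * (π / 2)) (v i) t := by
        simpa using (((hasDerivAt_id t).const_mul (v i)).const_add (q i)).add_const (n * (π / 2))
      convert (h1.cos).const_mul (v i ^ n) using 1
      rw [show q i + v i * t + (n + 1) * (π / 2) = q i + v i * t + n * (π / 2) + π / 2 by ring,
        cos_add_pi_div_two]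
      ring
    have zero : ∀ (f : ℝ → ℝ) (f' c t : ℝ), t ∈ Set.Ioo (0 : ℝ) 1 → HasDerivAt f f' t →
        (∀ s ∈ Set.Ioo (0 : ℝ) 1, f s = c) → f' = 0 := by
      intro f f' c t ht hf hc
      refine hf.unique ((hasDerivAt_const t c).congr_of_eventuallyEq ?_)
      filter_upwards [isOpen_Ioo.mem_nhds ht] with s hs using hc s hs
    intro n
    induction n with
    | zero =>
      intro t ht
      refine zero _ _ C t ht (by simpa using key 0 t) fun s hs => ?_
      simpa using h s hs
    | succ n ih =>
      intro t ht
      refine zero _ _ 0 t ht (key (n + 1) t) fun s hs => ?_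
      simpa using ih s hs
  obtain ⟨i₁, hi₁⟩ := Function.ne_iff.1 hv
  have hne : (Finset.univ : Finset (Fin d)).Nonempty := ⟨i₁, Finset.mem_univ _⟩
  obtain ⟨i₂, -, hmax⟩ := Finset.exists_max_image Finset.univ (fun i => |v i|) hne
  set V := |v i₂| with hV
  have hVpos : 0 < V := (abs_pos.2 hi₁).trans_le (hmax i₁ (Finset.mem_univ _))
  set r : Fin d → ℝ := fun i => v i / V with hr
  have hr1 : ∀ i, |r i| ≤ 1 := fun i => by
    rw [hr]; simp only [abs_div, abs_of_pos hVpos]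
    exact (div_le_one hVpos).2 (hmax i (Finset.mem_univ _))
  set a : Fin d → ℝ := fun i => q i + v i * (1 / 2) with ha
  have hhalf : (1 / 2 : ℝ) ∈ Set.Ioo (0 : ℝ) 1 := by norm_num
  -- Derivatives at the midpoint, normalised by the largest frequency.
  have hscaled : ∀ n : ℕ,
      ∑ i : Fin d, (2 : ℝ) ^ (i : ℕ) * (r i ^ (n + 1) * cos (a i + (n + 1) * (π / 2))) = 0 := by
    intro n
    have := hder n _ hhalf
    have h2 : (∑ i : Fin d, (2 : ℝ) ^ (i : ℕ) * (r i ^ (n + 1) * cos (a i + (n + 1) * (π / 2))))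
        = (∑ i : Fin d, (2 : ℝ) ^ (i : ℕ) * (v i ^ (n + 1) *
            cos (q i + v i * (1 / 2) + (n + 1) * (π / 2)))) / V ^ (n + 1) := by
      rw [Finset.sum_div]
      refine Finset.sum_congr rfl fun i _ => ?_
      simp only [hr, ha, div_pow]; ring
    rw [h2, this, zero_div]
  classical
  set S : Finset (Fin d) := Finset.univ.filter fun i => |r i| = 1 with hS
  -- Along orders in a fixed class mod 4 the phases are fixed, while powers of `r i` with `|r i| <
  -- 1` tend to 0. Only the extreme frequencies survive.
  have hlim : ∀ b : Fin d → ℝ,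
      (∀ m : ℕ, ∑ i : Fin d, (2 : ℝ) ^ (i : ℕ) * (r i ^ (4 * (m + 1)) * b i) = 0) →
      ∑ i ∈ S, (2 : ℝ) ^ (i : ℕ) * b i = 0 := by
    intro b hb
    have ht : Tendsto (fun m : ℕ => ∑ i : Fin d, (2 : ℝ) ^ (i : ℕ) * (r i ^ (4 * (m + 1)) * b i)) atTop
        (𝓝 (∑ i : Fin d, (2 : ℝ) ^ (i : ℕ) * ((if |r i| = 1 then 1 else 0) * b i))) := by
      refine tendsto_finsetSum _ fun i _ => Tendsto.const_mul _ (Tendsto.mul_const _ ?_)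
      have hpow : ∀ m : ℕ, r i ^ (4 * (m + 1)) = (|r i| ^ 4) ^ (m + 1) := fun m => by
        rw [pow_mul]; congr 1
        rw [show (4 : ℕ) = 2 * 2 by norm_num, pow_mul, pow_mul, sq_abs]
      simp only [hpow]
      split_ifs with h1
      · simp [h1]
      · refine (tendsto_pow_atTop_nhds_zero_of_lt_one (by positivity) ?_).comp (tendsto_add_atTop_nat 1)
        exact pow_lt_one₀ (abs_nonneg _) (lt_of_le_of_ne (hr1 i) h1) (by norm_num)
    simp only [hb] at ht
    have := tendsto_nhds_unique ht tendsto_const_nhds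
    rw [hS, Finset.sum_filter]
    refine Eq.trans ?_ this
    refine Finset.sum_congr rfl fun i _ => ?_
    split_ifs <;> simp
  have hcos : ∑ i ∈ S, (2 : ℝ) ^ (i : ℕ) * cos (a i) = 0 := by
    refine hlim _ fun m => ?_
    rw [← hscaled (4 * m + 3)]
    refine Finset.sum_congr rfl fun i _ => ?_
    rw [show a i + ((4 * m + 3 : ℕ) + 1) * (π / 2) = a i + ((m + 1 : ℕ) : ℝ) * (2 * π) by
      push_cast; ring, cos_add_nat_mul_two_pi]
    ring_nf
  have hsin : ∑ i ∈ S, (2 : ℝ) ^ (i : ℕ) * (r i * sin (a i)) = 0 := by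
    refine hlim _ fun m => ?_
    rw [← neg_eq_zero, ← hscaled (4 * m + 4), ← Finset.sum_neg_distrib]
    refine Finset.sum_congr rfl fun i _ => ?_
    rw [show a i + ((4 * m + 4 : ℕ) + 1) * (π / 2) = a i + π / 2 + ((m + 1 : ℕ) : ℝ) * (2 * π) by
      push_cast; ring, cos_add_nat_mul_two_pi, cos_add_pi_div_two]
    ring_nf
  have hSne : S.Nonempty := ⟨i₂, by
    simp only [hS, Finset.mem_filter, Finset.mem_univ, true_and, hr, abs_div, abs_of_pos hVpos]
    exact div_self hVpos.ne'⟩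
  obtain ⟨i₀, hi₀, hdom⟩ := exists_sum_erase_two_pow_lt S hSne
  have hrS : ∀ i ∈ S, r i = 1 ∨ r i = -1 := fun i hi =>
    eq_or_eq_neg_of_abs_eq (Finset.mem_filter.1 hi).2
  -- The unit vectors (cos a_i, r_i sin a_i), weighted by 2^i, sum to zero. Pairing with the vector
  -- of largest weight is contradictory: that weight exceeds the sum of all the others.
  have hcomb : ∑ i ∈ S, (2 : ℝ) ^ (i : ℕ) *
      (cos (a i) * cos (a i₀) + r i * sin (a i) * (r i₀ * sin (a i₀))) = 0 := by
    have : ∑ i ∈ S, (2 : ℝ) ^ (i : ℕ) *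
      (cos (a i) * cos (a i₀) + r i * sin (a i) * (r i₀ * sin (a i₀))) =
      (∑ i ∈ S, (2 : ℝ) ^ (i : ℕ) * cos (a i)) * cos (a i₀) +
      (∑ i ∈ S, (2 : ℝ) ^ (i : ℕ) * (r i * sin (a i))) * (r i₀ * sin (a i₀)) := by
      rw [Finset.sum_mul, Finset.sum_mul, ← Finset.sum_add_distrib]
      exact Finset.sum_congr rfl fun i _ => by ring
    rw [this, hcos, hsin]; ring
  rw [← Finset.add_sum_erase _ _ hi₀] at hcomb
  have h0 : cos (a i₀) * cos (a i₀) + r i₀ * sin (a i₀) * (r i₀ * sin (a i₀)) = 1 := by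
    have := sin_sq_add_cos_sq (a i₀)
    rcases hrS i₀ hi₀ with h | h <;> rw [h] <;> linarith
  have hle : ∑ i ∈ S.erase i₀, -((2 : ℝ) ^ (i : ℕ)) ≤ ∑ i ∈ S.erase i₀, (2 : ℝ) ^ (i : ℕ) *
      (cos (a i) * cos (a i₀) + r i * sin (a i) * (r i₀ * sin (a i₀))) := by
    refine Finset.sum_le_sum fun i hi => ?_
    have h1 : -1 ≤ cos (a i) * cos (a i₀) + r i * sin (a i) * (r i₀ * sin (a i₀)) := by
      have hs := neg_one_le_cos (a i - a i₀)
      have ht := neg_one_le_cos (a i + a i₀)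
      rw [cos_sub] at hs
      rw [cos_add] at ht
      rcases hrS i₀ hi₀ with h | h <;> rcases hrS i (Finset.mem_of_mem_erase hi) with h' | h' <;>
        rw [h, h'] <;> linarith
    have h2 : (0 : ℝ) < 2 ^ (i : ℕ) := by positivity
    nlinarith
  rw [Finset.sum_neg_distrib] at hle
  rw [h0] at hcomb
  linarith

/-! ### Oscillation on short segments. -/

/-- The sum of the cosines of the coordinates, of period one in each coordinate. -/
noncomputable def cosSum {d : ℕ} (x : EuclideanSpace ℝ (Fin d)) : ℝ :=
  ∑ i : Fin d, Real.cos (2 * Real.pi * x i)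

/-- A weighted sum of the cosines of the coordinates, not constant on any segment. -/
noncomputable def weightedCosSum {d : ℕ} (x : EuclideanSpace ℝ (Fin d)) : ℝ :=
  ∑ i : Fin d, (2 : ℝ) ^ (i : ℕ) * Real.cos (2 * Real.pi * x i)

theorem continuous_cosSum {d : ℕ} : Continuous (cosSum (d := d)) := by
  unfold cosSum; fun_prop

theorem continuous_weightedCosSum {d : ℕ} : Continuous (weightedCosSum (d := d)) := by
  unfold weightedCosSum; fun_prop

theorem isCompact_unitCube (d : ℕ) : IsCompact (unitCube d) := by
  have h : unitCube d = (EuclideanSpace.equiv (Fin d) ℝ).toHomeomorph ⁻¹'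
      (Set.univ.pi fun _ => Set.Icc 0 1) := by
    ext x
    simp only [unitCube, Set.mem_preimage, Set.mem_univ_pi, Set.mem_Icc]
    rfl
  rw [h]
  exact (Homeomorph.isCompact_preimage _).2 (isCompact_univ_pi fun _ => isCompact_Icc)

theorem convex_unitCube (d : ℕ) : Convex ℝ (unitCube d) := by
  intro x hx y hy a b ha hb hab i
  have h1 := hx i
  have h2 := hy i
  simp only [PiLp.add_apply, PiLp.smul_apply, smul_eq_mul]
  constructor
  · have := mul_nonneg ha h1.1; have := mul_nonneg hb h2.1; linarith
  · nlinarith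

theorem add_smul_mem_unitCube {d : ℕ} {x w : EuclideanSpace ℝ (Fin d)} (hx : x ∈ unitCube d)
    (hw : x + w ∈ unitCube d) {t : ℝ} (ht : t ∈ Set.Icc (0 : ℝ) 1) : x + t • w ∈ unitCube d := by
  have := (convex_unitCube d) hx hw (sub_nonneg.2 ht.2) ht.1 (by ring)
  convert this using 1
  module

/-- Segments of length `η` starting in the cube have uniformly positive oscillation. -/
theorem exists_oscillation_weightedCosSum (d : ℕ) {η : ℝ} (hη : 0 < η) :
    ∃ μ > 0, ∀ x ∈ unitCube d, ∀ w : EuclideanSpace ℝ (Fin d), ‖w‖ = η →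
      ∃ t ∈ Set.Icc (0 : ℝ) 1, μ ≤ |weightedCosSum (x + t • w) - weightedCosSum x| := by
  let E := EuclideanSpace ℝ (Fin d)
  -- Currying makes the oscillation along a segment a sup norm, continuous in the segment, so its
  -- positive minimum over a compact set is the uniform bound.
  let G : C((E × E) × Set.Icc (0 : ℝ) 1, ℝ) :=
    ⟨fun p => weightedCosSum (p.1.1 + (p.2 : ℝ) • p.1.2) - weightedCosSum p.1.1, by
      have := continuous_weightedCosSum (d := d)
      fun_prop⟩
  have hcont : Continuous fun p : E × E => ‖G.curry p‖ := G.curry.continuous.norm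
  have hcomp : IsCompact (unitCube d ×ˢ Metric.sphere (0 : E) η) :=
    (isCompact_unitCube d).prod (isCompact_sphere _ _)
  rcases (unitCube d ×ˢ Metric.sphere (0 : E) η).eq_empty_or_nonempty with he | hne
  · refine ⟨1, one_pos, fun x hx w hw => ?_⟩
    have : (x, w) ∈ unitCube d ×ˢ Metric.sphere (0 : E) η := ⟨hx, by simpa using hw⟩
    simp [he] at this
  obtain ⟨p, hp, hmin⟩ := hcomp.exists_isMinOn hne hcont.continuousOn
  refine ⟨‖G.curry p‖, norm_pos_iff.2 fun h0 => ?_, fun x hx w hw => ?_⟩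
  · have hw : ‖p.2‖ = η := by simpa using hp.2
    refine sum_two_pow_mul_cos_not_const (fun i => 2 * Real.pi * p.1 i)
      (fun i => 2 * Real.pi * p.2 i) (fun hz => ?_) (weightedCosSum p.1) fun t ht => ?_
    · have : p.2 = 0 := by
        ext i
        have := congrFun hz i
        simpa [Real.pi_ne_zero] using this
      rw [this, norm_zero] at hw
      exact hη.ne hw
    · have := DFunLike.congr_fun h0 ⟨t, Set.Ioo_subset_Icc_self ht⟩
      have h2 : weightedCosSum (p.1 + t • p.2) - weightedCosSum p.1 = 0 := this
      rw [← sub_eq_zero, ← h2, weightedCosSum]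
      congr 1
      refine Finset.sum_congr rfl fun i _ => ?_
      rw [show (p.1 + t • p.2) i = p.1 i + t * p.2 i from rfl]
      ring_nf
  · by_contra! hcon
    have hle : ‖G.curry p‖ ≤ ‖G.curry (x, w)‖ := hmin (show (x, w) ∈ _ from ⟨hx, by simpa using hw⟩)
    obtain ⟨t, -, ht⟩ := isCompact_univ.exists_isMaxOn (s := (Set.univ : Set (Set.Icc (0 : ℝ) 1)))
      ⟨⟨0, by simp⟩, Set.mem_univ _⟩ ((G.curry (x, w)).continuous.norm.continuousOn)
    have h1 : ‖G.curry (x, w)‖ ≤ ‖G.curry (x, w) t‖ :=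
      (ContinuousMap.norm_le _ (norm_nonneg _)).2 fun s => ht (Set.mem_univ s)
    have h2 := hcon t t.2
    have h3 : ‖G.curry (x, w) t‖ = |weightedCosSum (x + (t : ℝ) • w) - weightedCosSum x| := rfl
    linarith

/-- A wave of high frequency in `weightedCosSum` attains its maximum on every segment of length
`η` starting in the cube. -/
theorem exists_sin_weightedCosSum_eq_one (d : ℕ) {η : ℝ} (hη : 0 < η) :
    ∃ M : ℝ, ∀ x ∈ unitCube d, ∀ w : EuclideanSpace ℝ (Fin d), ‖w‖ = η →
      ∃ t ∈ Set.Icc (0 : ℝ) 1, Real.sin (2 * Real.pi * (M * weightedCosSum (x + t • w))) = 1 := by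
  obtain ⟨μ, hμ, h⟩ := exists_oscillation_weightedCosSum d hη
  -- With this factor the phase varies by at least 1 along the segment, hence takes a value in ℤ +
  -- 1/4.
  refine ⟨μ⁻¹, fun x hx w hw => ?_⟩
  obtain ⟨t, ht, hosc⟩ := h x hx w hw
  set f : ℝ → ℝ := fun t => μ⁻¹ * weightedCosSum (x + t • w) with hf
  have hfc : Continuous f := by
    have := continuous_weightedCosSum (d := d)
    fun_prop
  have hft : 1 ≤ |f t - f 0| := by
    have : f t - f 0 = μ⁻¹ * (weightedCosSum (x + t • w) - weightedCosSum x) := by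
      simp [hf, mul_sub]
    rw [this, abs_mul, abs_of_pos (inv_pos.2 hμ), ← div_eq_inv_mul]
    exact (one_le_div hμ).2 hosc
  have hsub : Set.uIcc (f 0) (f t) ⊆ f '' Set.Icc 0 1 :=
    (intermediate_value_uIcc hfc.continuousOn).trans (Set.image_mono (by
      rw [Set.uIcc_of_le ht.1]; exact Set.Icc_subset_Icc_right ht.2))
  have hmem : (⌈min (f 0) (f t) - 1 / 4⌉ : ℝ) + 1 / 4 ∈ Set.uIcc (f 0) (f t) := by
    have h1 := Int.le_ceil (min (f 0) (f t) - 1 / 4)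
    have h2 := Int.ceil_lt_add_one (min (f 0) (f t) - 1 / 4)
    have h3 := max_sub_min_eq_abs (f 0) (f t)
    rw [Set.uIcc, Set.mem_Icc]
    constructor
    · linarith
    · linarith
  obtain ⟨s, hs, hfs⟩ := hsub hmem
  refine ⟨s, hs, ?_⟩
  change Real.sin (2 * Real.pi * f s) = 1
  rw [hfs, show 2 * Real.pi * ((⌈min (f 0) (f t) - 1 / 4⌉ : ℝ) + 1 / 4) =
    Real.pi / 2 + (⌈min (f 0) (f t) - 1 / 4⌉ : ℝ) * (2 * Real.pi) by ring,
    Real.sin_add_int_mul_two_pi, Real.sin_pi_div_two]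

/-! ### Flats and the boundary of the cube. -/

/-- A translate of a subspace that meets the cube contains a point of the cube with at least as
many coordinates in `{0, 1}` as the dimension of the subspace. -/
theorem exists_le_card_filter_coord {d : ℕ} (W : Submodule ℝ (EuclideanSpace ℝ (Fin d)))
    {x : EuclideanSpace ℝ (Fin d)} (hx : x ∈ unitCube d) :
    ∀ n ≤ Module.finrank ℝ W, ∃ w ∈ W, x + w ∈ unitCube d ∧
      n ≤ (Finset.univ.filter fun i => (x + w) i = 0 ∨ (x + w) i = 1).card := by
  intro n
  induction n with
  | zero => exact fun _ => ⟨0, W.zero_mem, by simpa using hx, Nat.zero_le _⟩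
  | succ n ih =>
    intro hn
    obtain ⟨w, hw, hQ, hcard⟩ := ih (by omega)
    set y := x + w with hy
    set I := Finset.univ.filter fun i => y i = 0 ∨ y i = 1 with hI
    by_cases hlt : n + 1 ≤ I.card
    · exact ⟨w, hw, hQ, hlt⟩
    let φ : W →ₗ[ℝ] (I → ℝ) :=
      { toFun := fun u i => (u : EuclideanSpace ℝ (Fin d)) i
        map_add' := fun _ _ => rfl
        map_smul' := fun _ _ => rfl }
    have hker : LinearMap.ker φ ≠ ⊥ := LinearMap.ker_ne_bot_of_finrank_lt (by
      rw [Module.finrank_fintype_fun_eq_card, Fintype.card_coe]; omega)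
    obtain ⟨u, hu, hu0⟩ := Submodule.exists_mem_ne_zero_of_ne_bot hker
    have huI : ∀ i ∈ I, (u : EuclideanSpace ℝ (Fin d)) i = 0 := fun i hi =>
      congrFun (LinearMap.mem_ker.1 hu) ⟨i, hi⟩
    obtain ⟨j, hj⟩ : ∃ j, (u : EuclideanSpace ℝ (Fin d)) j ≠ 0 := by
      by_contra! hcon
      exact hu0 (Subtype.ext (by ext i; simpa using hcon i))
    -- Moving along `u` keeps the coordinates in `I`; at the largest admissible `t` another
    -- coordinate reaches 0 or 1.
    set T : Set ℝ := {t | y + t • (u : EuclideanSpace ℝ (Fin d)) ∈ unitCube d} with hT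
    have hTclosed : IsClosed T := (isCompact_unitCube d).isClosed.preimage (by fun_prop)
    have hTsub : T ⊆ Metric.closedBall 0 (1 / |(u : EuclideanSpace ℝ (Fin d)) j|) := by
      intro t ht
      have h1 := ht j
      have h2 := hQ j
      simp only [PiLp.add_apply, PiLp.smul_apply, smul_eq_mul] at h1
      rw [mem_closedBall_zero_iff, Real.norm_eq_abs, le_div_iff₀ (abs_pos.2 hj), ← abs_mul, abs_le]
      constructor <;> linarith
    have hTcomp : IsCompact T := (isCompact_closedBall _ _).of_isClosed_subset hTclosed hTsub
    obtain ⟨t, ht, hmax⟩ := hTcomp.exists_isMaxOn ⟨0, by simpa [hT] using hQ⟩ continuousOn_id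
    refine ⟨w + t • (u : EuclideanSpace ℝ (Fin d)), W.add_mem hw (W.smul_mem _ u.2), ?_, ?_⟩
    · rw [← add_assoc]; exact ht
    rw [← add_assoc, ← hy]
    set z := y + t • (u : EuclideanSpace ℝ (Fin d)) with hz
    have hzI : ∀ i ∈ I, z i = y i := fun i hi => by simp [hz, huI i hi]
    have hnew : ∃ i ∉ I, z i = 0 ∨ z i = 1 := by
      by_contra! hcon
      have hev : ∀ᶠ s in nhds t, s ∈ T := by
        refine Filter.eventually_all.2 fun i => ?_
        by_cases hi : i ∈ I
        · refine Filter.Eventually.of_forall fun s => ?_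
          simpa [huI i hi] using hQ i
        · have hc : Continuous fun s : ℝ => (y + s • (u : EuclideanSpace ℝ (Fin d))) i := by
            fun_prop
          have h0 : 0 < z i := lt_of_le_of_ne (ht i).1 (Ne.symm (hcon i hi).1)
          have h1 : z i < 1 := lt_of_le_of_ne (ht i).2 (hcon i hi).2
          filter_upwards [hc.continuousAt.eventually (lt_mem_nhds h0),
            hc.continuousAt.eventually (gt_mem_nhds h1)] with s hs hs'
          exact ⟨hs.le, hs'.le⟩
      obtain ⟨s, hs, hst⟩ := ((hev.filter_mono nhdsWithin_le_nhds).and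
        (self_mem_nhdsWithin : Set.Ioi t ∈ nhdsWithin t (Set.Ioi t))).exists
      exact absurd (hmax hs) (not_le.2 hst)
    obtain ⟨i, hi, hi'⟩ := hnew
    refine (Nat.succ_le_succ hcard).trans ?_
    rw [Nat.succ_eq_add_one, ← Finset.card_insert_of_notMem hi]
    refine Finset.card_le_card fun k hk => ?_
    rcases Finset.mem_insert.1 hk with rfl | hk
    · simpa using hi'
    · have := (Finset.mem_filter.1 hk).2
      simpa [hzI k hk] using this

theorem cosSum_ge_of_card {d : ℕ} (x : EuclideanSpace ℝ (Fin d)) (s : Finset (Fin d)) {ε : ℝ}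
    (hε : 0 ≤ ε) (hs : ∀ i ∈ s, 1 - ε ≤ Real.cos (2 * Real.pi * x i)) :
    2 * (s.card : ℝ) - d - d * ε ≤ cosSum x := by
  classical
  have hcard : s.card ≤ d := by simpa using s.card_le_univ
  have h1 : (s.card : ℝ) * (1 - ε) ≤ ∑ i ∈ s, Real.cos (2 * Real.pi * x i) := by
    simpa using Finset.card_nsmul_le_sum s _ _ hs
  have h2 : ((d : ℝ) - s.card) * (-1) ≤ ∑ i ∈ sᶜ, Real.cos (2 * Real.pi * x i) := by
    have := Finset.card_nsmul_le_sum sᶜ (fun i => Real.cos (2 * Real.pi * x i)) (-1)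
      fun i _ => Real.neg_one_le_cos _
    rw [Finset.card_compl, Fintype.card_fin, nsmul_eq_mul, Nat.cast_sub hcard] at this
    exact this
  have h3 : (s.card : ℝ) ≤ d := by exact_mod_cast hcard
  rw [cosSum, ← Finset.sum_add_sum_compl s]
  nlinarith

theorem abs_cos_two_pi_mul_sub_le (a b : ℝ) :
    |Real.cos (2 * Real.pi * a) - Real.cos (2 * Real.pi * b)| ≤ 2 * Real.pi * |a - b| := by
  have := Real.abs_cos_sub_cos_le (2 * Real.pi * a) (2 * Real.pi * b)
  rwa [← mul_sub, abs_mul, abs_of_pos Real.two_pi_pos] at this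

theorem abs_cosSum_sub_le {d : ℕ} (x y : EuclideanSpace ℝ (Fin d)) :
    |cosSum x - cosSum y| ≤ d * (2 * Real.pi * ‖x - y‖) := by
  rw [cosSum, cosSum, ← Finset.sum_sub_distrib]
  refine (Finset.abs_sum_le_sum_abs _ _).trans ?_
  have : ∀ i ∈ (Finset.univ : Finset (Fin d)),
      |Real.cos (2 * Real.pi * x i) - Real.cos (2 * Real.pi * y i)| ≤ 2 * Real.pi * ‖x - y‖ := by
    intro i _
    refine (abs_cos_two_pi_mul_sub_le _ _).trans ?_
    have := PiLp.norm_apply_le (x - y) i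
    rw [PiLp.sub_apply, Real.norm_eq_abs] at this
    exact mul_le_mul_of_nonneg_left this Real.two_pi_pos.le
  simpa using Finset.sum_le_card_nsmul _ _ _ this

/-- If exactly as many coordinates of a point of the cube are close to `0` or `1` as the dimension
of the subspace, the subspace contains a short vector pointing into the cube. -/
theorem exists_norm_eq_add_mem_unitCube {d : ℕ} (W : Submodule ℝ (EuclideanSpace ℝ (Fin d)))
    {y : EuclideanSpace ℝ (Fin d)} (hy : y ∈ unitCube d) {η : ℝ} (hη : 0 < η) (hη' : η ≤ 1)
    (hW : 0 < Module.finrank ℝ W) (I : Finset (Fin d)) (hI : ∀ i ∈ I, y i = 0 ∨ y i = 1)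
    (hIc : ∀ i ∉ I, η ≤ y i ∧ y i ≤ 1 - η) (hcard : I.card = Module.finrank ℝ W) :
    ∃ w ∈ W, ‖w‖ = η ∧ y + w ∈ unitCube d := by
  suffices h : ∃ u ∈ W, u ≠ 0 ∧ ∀ i ∈ I, (y i = 0 → 0 ≤ u i) ∧ (y i = 1 → u i ≤ 0) by
    obtain ⟨u, hu, hu0, hdir⟩ := h
    have hpos : 0 < ‖u‖ := norm_pos_iff.2 hu0
    have hnorm : ‖(η / ‖u‖) • u‖ = η := by
      rw [norm_smul, Real.norm_of_nonneg (by positivity), div_mul_cancel₀ _ hpos.ne']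
    refine ⟨(η / ‖u‖) • u, W.smul_mem _ hu, hnorm, fun i => ?_⟩
    have hle := PiLp.norm_apply_le ((η / ‖u‖) • u) i
    rw [hnorm, Real.norm_eq_abs, abs_le] at hle
    rw [PiLp.add_apply]
    have hyi := hy i
    by_cases hi : i ∈ I
    · have hc : 0 ≤ η / ‖u‖ := by positivity
      rcases hI i hi with h | h
      · have := mul_nonneg hc ((hdir i hi).1 h)
        simp only [PiLp.smul_apply, smul_eq_mul] at hle ⊢
        constructor <;> linarith
      · have := mul_nonpos_of_nonneg_of_nonpos hc ((hdir i hi).2 h)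
        simp only [PiLp.smul_apply, smul_eq_mul] at hle ⊢
        constructor <;> linarith
    · have := hIc i hi
      constructor <;> linarith
  let φ : W →ₗ[ℝ] (I → ℝ) :=
    { toFun := fun u i => (u : EuclideanSpace ℝ (Fin d)) i
      map_add' := fun _ _ => rfl
      map_smul' := fun _ _ => rfl }
  -- If restriction to `I` is injective, it is surjective by dimension, and the inward values 1 - 2
  -- y_i can be prescribed. Otherwise a nonzero kernel vector leaves those coordinates fixed.
  by_cases hinj : Function.Injective φ
  · have hsurj : Function.Surjective φ :=
      (LinearMap.injective_iff_surjective_of_finrank_eq_finrank (by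
        rw [Module.finrank_fintype_fun_eq_card, Fintype.card_coe, hcard])).1 hinj
    obtain ⟨u, hu⟩ := hsurj fun i => 1 - 2 * y i
    have hui : ∀ i ∈ I, (u : EuclideanSpace ℝ (Fin d)) i = 1 - 2 * y i := fun i hi =>
      congrFun hu ⟨i, hi⟩
    refine ⟨u, u.2, fun h0 => ?_, fun i hi => ⟨fun h => ?_, fun h => ?_⟩⟩
    · obtain ⟨i, hi⟩ := Finset.card_pos.1 (hcard ▸ hW)
      have := hui i hi
      rw [h0, PiLp.zero_apply] at this
      rcases hI i hi with h | h <;> rw [h] at this <;> norm_num at this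
    · rw [hui i hi, h]; norm_num
    · rw [hui i hi, h]; norm_num
  · rw [← LinearMap.ker_eq_bot] at hinj
    obtain ⟨u, hu, hu0⟩ := Submodule.exists_mem_ne_zero_of_ne_bot hinj
    have huI : ∀ i ∈ I, (u : EuclideanSpace ℝ (Fin d)) i = 0 := fun i hi =>
      congrFun (LinearMap.mem_ker.1 hu) ⟨i, hi⟩
    exact ⟨u, u.2, by simpa using hu0, fun i hi => by simp [huI i hi]⟩

/-! ### The odd periodic function. -/

theorem cosSum_reflect {d : ℕ} {x y : EuclideanSpace ℝ (Fin d)} (h : ∀ i, x i + y i = 1 / 2) :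
    cosSum y = -cosSum x := by
  rw [cosSum, cosSum, ← Finset.sum_neg_distrib]
  refine Finset.sum_congr rfl fun i _ => ?_
  rw [← Real.cos_pi_sub]
  congr 1
  linear_combination 2 * Real.pi * h i

theorem weightedCosSum_reflect {d : ℕ} {x y : EuclideanSpace ℝ (Fin d)}
    (h : ∀ i, x i + y i = 1 / 2) : weightedCosSum y = -weightedCosSum x := by
  rw [weightedCosSum, weightedCosSum, ← Finset.sum_neg_distrib]
  refine Finset.sum_congr rfl fun i _ => ?_
  rw [← mul_neg, ← Real.cos_pi_sub]
  congr 2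
  linear_combination 2 * Real.pi * h i

theorem cos_two_pi_mul_eq_of_sub_int {a b : ℝ} {m : ℤ} (h : a - b = m) :
    Real.cos (2 * Real.pi * a) = Real.cos (2 * Real.pi * b) := by
  rw [← Real.cos_add_int_mul_two_pi (2 * Real.pi * b) m, ← h]
  congr 1
  ring

theorem cosSum_periodic {d : ℕ} {x y : EuclideanSpace ℝ (Fin d)}
    (h : ∀ i, ∃ m : ℤ, x i - y i = (m : ℝ)) : cosSum x = cosSum y :=
  Finset.sum_congr rfl fun i _ => (h i).elim fun _ hm => cos_two_pi_mul_eq_of_sub_int hm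

theorem weightedCosSum_periodic {d : ℕ} {x y : EuclideanSpace ℝ (Fin d)}
    (h : ∀ i, ∃ m : ℤ, x i - y i = (m : ℝ)) : weightedCosSum x = weightedCosSum y :=
  Finset.sum_congr rfl fun i _ =>
    (h i).elim fun _ hm => congrArg _ (cos_two_pi_mul_eq_of_sub_int hm)

/-- If `d ≤ 2k`, there is a continuous periodic function, odd under a reflection, that is large
somewhere on the part in the cube of each `k`-dimensional flat meeting the cube. -/
theorem exists_odd_periodic_large_on_flats {k d : ℕ} (hk : 0 < k) (hd : d ≤ 2 * k) :
    ∃ F : EuclideanSpace ℝ (Fin d) → ℝ, Continuous F ∧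
      (∀ x y, (∀ i, x i + y i = 1 / 2) → F y = -F x) ∧
      (∀ x y, (∀ i, ∃ m : ℤ, x i - y i = (m : ℝ)) → F x = F y) ∧
      ∀ W : Submodule ℝ (EuclideanSpace ℝ (Fin d)), Module.finrank ℝ W = k →
        ∀ x ∈ unitCube d, ∃ w ∈ W, x + w ∈ unitCube d ∧ 1 / 2 ≤ F (x + w) := by
  have hvertex : ∀ y : EuclideanSpace ℝ (Fin d),
      ∀ i ∈ Finset.univ.filter fun i => y i = 0 ∨ y i = 1,
        1 - 0 ≤ Real.cos (2 * Real.pi * y i) := by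
    intro y i hi
    rcases (Finset.mem_filter.1 hi).2 with h | h <;> simp [h]
  rcases hd.lt_or_eq with hlt | heq
  · refine ⟨cosSum, continuous_cosSum, fun _ _ => cosSum_reflect, fun _ _ => cosSum_periodic,
      fun W hW x hx => ?_⟩
    obtain ⟨w, hw, hQ, hcard⟩ := exists_le_card_filter_coord W hx k hW.ge
    refine ⟨w, hw, hQ, ?_⟩
    have h1 := cosSum_ge_of_card (x + w) _ le_rfl (hvertex _)
    have h2 : (k : ℝ) ≤ _ := Nat.cast_le.2 hcard
    have h3 : (d : ℝ) + 1 ≤ 2 * k := by exact_mod_cast hlt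
    linarith
  · have hd0 : (0 : ℝ) < d := by
      rw [heq]; positivity
    have hd1 : (1 : ℝ) ≤ d := by exact_mod_cast (by omega : 1 ≤ d)
    -- Moving every coordinate by at most η changes `cosSum` by at most 1/4.
    set η : ℝ := 1 / (8 * Real.pi * d) with hηdef
    have hη : 0 < η := by have := Real.pi_pos; positivity
    have hηd : d * (2 * Real.pi * η) = 1 / 4 := by
      rw [hηdef]; field_simp [Real.pi_ne_zero]; norm_num
    have hη1 : η ≤ 1 := by
      rw [hηdef, div_le_one (by have := Real.pi_pos; positivity)]
      nlinarith [Real.pi_gt_three]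
    obtain ⟨M, hM⟩ := exists_sin_weightedCosSum_eq_one d hη
    refine ⟨fun x => cosSum x + Real.sin (2 * Real.pi * (M * weightedCosSum x)), ?_, ?_, ?_, ?_⟩
    · have h1 := continuous_cosSum (d := d)
      have h2 := continuous_weightedCosSum (d := d)
      fun_prop
    · intro x y h
      simp only [cosSum_reflect h, weightedCosSum_reflect h, mul_neg, Real.sin_neg]
      ring
    · intro x y h
      simp only [cosSum_periodic h, weightedCosSum_periodic h]
    · intro W hW x hx
      obtain ⟨w, hw, hQ, hcard⟩ := exists_le_card_filter_coord W hx k hW.ge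
      set y := x + w with hy
      set I := Finset.univ.filter fun i => y i = 0 ∨ y i = 1 with hI
      set J := Finset.univ.filter fun i => y i < η ∨ 1 - η < y i with hJ
      have hIJ : I ⊆ J := fun i hi => by
        refine Finset.mem_filter.2 ⟨Finset.mem_univ _, ?_⟩
        rcases (Finset.mem_filter.1 hi).2 with h | h
        · exact Or.inl (by linarith)
        · exact Or.inr (by linarith)
      -- With k + 1 coordinates near {0, 1}, `cosSum` is at least 2 - 1/4, enough to absorb a sine
      -- of -1. Otherwise there is room for a segment of length η in the flat; the sine equals 1
      -- somewhere on it and `cosSum` stays at least -1/4.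
      by_cases hJk : k + 1 ≤ J.card
      · refine ⟨w, hw, hQ, ?_⟩
        have h1 := cosSum_ge_of_card y J (ε := 2 * Real.pi * η)
          (by have := Real.pi_pos; positivity) (by
            intro i hi
            have hyi := hQ i
            have key : ∀ b : ℝ, Real.cos (2 * Real.pi * b) = 1 → |b - y i| ≤ η →
                1 - 2 * Real.pi * η ≤ Real.cos (2 * Real.pi * y i) := by
              intro b hb hle
              have h1 := (abs_le.1 (abs_cos_two_pi_mul_sub_le b (y i))).2
              have h2 := mul_le_mul_of_nonneg_left hle Real.two_pi_pos.le
              linarith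
            rcases (Finset.mem_filter.1 hi).2 with h | h
            · exact key 0 (by simp) (abs_le.2 ⟨by linarith, by linarith⟩)
            · exact key 1 (by simp) (abs_le.2 ⟨by linarith, by linarith⟩))
        have h2 : (k : ℝ) + 1 ≤ J.card := by exact_mod_cast hJk
        have h3 : (d : ℝ) = 2 * k := by exact_mod_cast heq
        have h4 := Real.neg_one_le_sin (2 * Real.pi * (M * weightedCosSum y))
        change 1 / 2 ≤ cosSum y + _
        linarith
      · have hIJeq : I = J := Finset.eq_of_subset_of_card_le hIJ (by omega)
        have hIk : I.card = k := by rw [hIJeq] at hcard ⊢; omega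
        obtain ⟨u, hu, hnorm, hQu⟩ := exists_norm_eq_add_mem_unitCube W hQ hη hη1 (hW ▸ hk) I
          (fun i hi => (Finset.mem_filter.1 hi).2) (fun i hi => by
            rw [hIJeq] at hi
            simp only [hJ, Finset.mem_filter, Finset.mem_univ, true_and, not_or, not_lt] at hi
            exact hi) (hIk.trans hW.symm)
        obtain ⟨t, ht, hsin⟩ := hM y hQ u hnorm
        refine ⟨w + t • u, W.add_mem hw (W.smul_mem _ hu), ?_, ?_⟩
        · rw [← add_assoc]; exact add_smul_mem_unitCube hQ hQu ht
        rw [← add_assoc, ← hy]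
        beta_reduce
        rw [hsin]
        have h1 := cosSum_ge_of_card y _ le_rfl (hvertex y)
        have h2 : (k : ℝ) ≤ I.card := Nat.cast_le.2 hcard
        have h3 : (d : ℝ) = 2 * k := by exact_mod_cast heq
        have h4 := (abs_le.1 (abs_cosSum_sub_le (y + t • u) y)).1
        have h5 : ‖y + t • u - y‖ ≤ η := by
          rw [add_sub_cancel_left, norm_smul, hnorm, Real.norm_of_nonneg ht.1]
          exact mul_le_of_le_one_left hη.le ht.2
        have h6 : d * (2 * Real.pi * ‖y + t • u - y‖) ≤ d * (2 * Real.pi * η) :=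
          mul_le_mul_of_nonneg_left (mul_le_mul_of_nonneg_left h5 Real.two_pi_pos.le) hd0.le
        linarith

/-! ### Construction of the set for `d ≤ 2 * k`. -/

/-- If `d ≤ 2k`, there is a `(2,k,d)`-set: the points of the cube whose dilations by powers of a
large number all lie in a periodic set disjoint from its reflection. -/
theorem exists_isTwoSet {k d : ℕ} (hk : 0 < k) (hd : d ≤ 2 * k) :
    ∃ K : Set (EuclideanSpace ℝ (Fin d)), IsTwoSet k d K := by
  obtain ⟨F, hFc, hodd, hper, hF⟩ := exists_odd_periodic_large_on_flats hk hd
  have hQc := isCompact_unitCube d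
  obtain ⟨δ, hδ, hunif⟩ := Metric.uniformContinuousOn_iff.1
    (hQc.uniformContinuousOn_of_continuous hFc.continuousOn) (1 / 4) (by norm_num)
  obtain ⟨D, hD⟩ := hQc.isBounded.subset_closedBall 0
  obtain ⟨N, hN⟩ := exists_nat_gt (max 1 (2 * D / δ))
  have hN1 : (1 : ℝ) < N := (le_max_left _ _).trans_lt hN
  have hN0 : (0 : ℝ) < N := one_pos.trans hN1
  have hND : 2 * D / δ < N := (le_max_right _ _).trans_lt hN
  -- Self-similarity: after finding `y` with F(y) ≥ 1/2, magnify by N, translate the integer cell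
  -- containing N y to the unit cube, and apply induction there. Pulled back, the correction is at
  -- most 2D/N < δ, so F(y) drops by less than 1/4.
  have hlevel : ∀ W : Submodule ℝ (EuclideanSpace ℝ (Fin d)), Module.finrank ℝ W = k →
      ∀ n : ℕ, ∀ x ∈ unitCube d, ∃ w ∈ W, x + w ∈ unitCube d ∧
        ∀ j < n, 1 / 4 ≤ F ((N : ℝ) ^ j • (x + w)) := by
    intro W hW n
    induction n with
    | zero => exact fun x hx => ⟨0, W.zero_mem, by simpa using hx, by simp⟩
    | succ n ih =>
      intro x hx
      obtain ⟨w, hw, hy, hFy⟩ := hF W hW x hx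
      set y := x + w with hydef
      have hcell : ∀ i, ∃ e : ℤ, 0 ≤ e ∧ (e : ℝ) + 1 ≤ N ∧ 0 ≤ N * y i - e ∧ N * y i - e ≤ 1 := by
        intro i
        have hyi := hy i
        by_cases h1 : y i = 1
        -- The floor would be N here, giving a cell outside the magnified cube.
        · refine ⟨N - 1, ?_, ?_, ?_, ?_⟩
          · have : (1 : ℤ) < N := by exact_mod_cast hN1
            omega
          all_goals push_cast; linarith [congrArg (fun r => (N : ℝ) * r) h1]
        · have hlt : y i < 1 := lt_of_le_of_ne hyi.2 h1
          refine ⟨⌊N * y i⌋, Int.floor_nonneg.2 (mul_nonneg hN0.le hyi.1), ?_, ?_, ?_⟩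
          · have : ⌊N * y i⌋ < (N : ℤ) := Int.floor_lt.2 (by push_cast; nlinarith)
            exact_mod_cast this
          · linarith [Int.floor_le (N * y i)]
          · linarith [Int.lt_floor_add_one (N * y i)]
      choose e he0 heN hel heu using hcell
      let E : EuclideanSpace ℝ (Fin d) := WithLp.toLp 2 fun i => (e i : ℝ)
      have hE : ∀ i, E i = e i := fun i => rfl
      have hsub : (N : ℝ) • y - E ∈ unitCube d := fun i => by
        simpa [hE] using And.intro (hel i) (heu i)
      obtain ⟨w', hw', hy', hFy'⟩ := ih _ hsub
      set y' := (N : ℝ) • y - E + w' with hy'def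
      have hcomb : (N : ℝ) • (y + (N : ℝ)⁻¹ • w') = y' + E := by
        rw [smul_add, smul_inv_smul₀ hN0.ne', hy'def]; abel
      have hcoord : ∀ i, N * (y + (N : ℝ)⁻¹ • w') i = y' i + e i := fun i => by
        have := congrArg (fun z : EuclideanSpace ℝ (Fin d) => z i) hcomb
        simpa only [PiLp.smul_apply, PiLp.add_apply, smul_eq_mul, hE] using this
      have hQ : y + (N : ℝ)⁻¹ • w' ∈ unitCube d := by
        intro i
        have h1 := hcoord i
        have h2 := hy' i
        have h3 : (0 : ℝ) ≤ e i := by exact_mod_cast he0 i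
        have h4 := heN i
        constructor
        · by_contra! hneg
          nlinarith
        · by_contra! hneg
          nlinarith
      refine ⟨w + (N : ℝ)⁻¹ • w', W.add_mem hw (W.smul_mem _ hw'), by rwa [← add_assoc], ?_⟩
      rw [← add_assoc, ← hydef]
      intro j hj
      rcases j with _ | j
      · have hdist : dist (y + (N : ℝ)⁻¹ • w') y < δ := by
          have h1 : w' = y' - ((N : ℝ) • y - E) := by rw [hy'def]; abel
          have h2 : ‖y'‖ ≤ D := by simpa using hD hy'
          have h3 : ‖(N : ℝ) • y - E‖ ≤ D := by simpa using hD hsub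
          have h4 : ‖w'‖ ≤ 2 * D := by
            rw [h1]; exact (norm_sub_le _ _).trans (by linarith)
          rw [dist_eq_norm, add_sub_cancel_left, norm_smul, norm_inv, Real.norm_of_nonneg hN0.le,
            inv_mul_lt_iff₀ hN0]
          rw [div_lt_iff₀ hδ] at hND
          linarith
        have := hunif _ hQ _ hy hdist
        rw [Real.dist_eq, abs_lt] at this
        simp only [pow_zero, one_smul]
        linarith
      · have h1 : (N : ℝ) ^ (j + 1) • (y + (N : ℝ)⁻¹ • w') = (N : ℝ) ^ j • (y' + E) := by
          rw [pow_succ, mul_smul, hcomb]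
        rw [h1, hper _ ((N : ℝ) ^ j • y')]
        · exact hFy' j (by omega)
        · intro i
          refine ⟨N ^ j * e i, ?_⟩
          simp only [PiLp.smul_apply, PiLp.add_apply, smul_eq_mul, hE]
          push_cast; ring
  let L : ℕ → Set (EuclideanSpace ℝ (Fin d)) := fun n =>
    unitCube d ∩ {x | ∀ j < n, 1 / 4 ≤ F ((N : ℝ) ^ j • x)}
  have hLclosed : ∀ n, IsClosed (L n) := fun n => by
    refine hQc.isClosed.inter ?_
    simp only [Set.ofPred_forall]
    exact isClosed_iInter fun j => isClosed_iInter fun _ =>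
      isClosed_le continuous_const (hFc.comp (continuous_const_smul _))
  have hKc : IsCompact (⋂ n, L n) :=
    hQc.of_isClosed_subset (isClosed_iInter hLclosed) fun x hx => (Set.mem_iInter.1 hx 0).1
  refine ⟨⋂ n, L n, hKc, fun x hx => (Set.mem_iInter.1 hx 0).1, ?_, ?_⟩
  · rintro V hV ⟨p, hpV, hpQ⟩
    have hVc : IsClosed (V : Set (EuclideanSpace ℝ (Fin d))) := V.closed_of_finiteDimensional
    rw [Set.inter_iInter]
    refine IsCompact.nonempty_iInter_of_sequence_nonempty_isCompact_isClosed _ ?_ ?_ ?_ ?_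
    · exact fun n x hx => ⟨hx.1, hx.2.1, fun j hj => hx.2.2 j (by omega)⟩
    · intro n
      obtain ⟨w, hw, hQ, h⟩ := hlevel V.direction hV n p hpQ
      refine ⟨p + w, ?_, hQ, h⟩
      rw [add_comm]
      exact AffineSubspace.vadd_mem_of_mem_direction hw hpV
    · exact hQc.of_isClosed_subset (hVc.inter (hLclosed 0)) fun x hx => hx.2.1
    · exact fun n => hVc.inter (hLclosed n)
  · rw [(hKc.add hKc).isClosed.isNowhereDense_iff, Set.eq_empty_iff_forall_notMem]
    intro p hp
    obtain ⟨r, hr, hball⟩ := Metric.mem_nhds_iff.1 (mem_interior_iff_mem_nhds.1 hp)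
    -- Within D/N^n of `p` lies a point whose dilation by N^n has all coordinates in 1/2 + ℤ.
    have hround : ∀ n : ℕ, ∃ q ∈ unitCube d,
        ∀ i, ∃ m : ℤ, (N : ℝ) ^ n * p i + q i - 1 / 2 = m := by
      intro n
      refine ⟨WithLp.toLp 2 fun i => ⌈(N : ℝ) ^ n * p i - 1 / 2⌉ + 1 / 2 - (N : ℝ) ^ n * p i,
        fun i => ?_, fun i => ⟨⌈(N : ℝ) ^ n * p i - 1 / 2⌉, by simp⟩⟩
      have h1 := Int.le_ceil ((N : ℝ) ^ n * p i - 1 / 2)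
      have h2 := Int.ceil_lt_add_one ((N : ℝ) ^ n * p i - 1 / 2)
      simp only
      constructor <;> linarith
    obtain ⟨n, hn⟩ := pow_unbounded_of_one_lt (D / r) hN1
    obtain ⟨q, hqQ, hqm⟩ := hround n
    have hq : ‖q‖ ≤ D := by simpa using hD hqQ
    have hNn : (0 : ℝ) < (N : ℝ) ^ n := by positivity
    have hmem : p + ((N : ℝ) ^ n)⁻¹ • q ∈ Metric.ball p r := by
      rw [mem_ball_iff_norm, add_sub_cancel_left, norm_smul, norm_inv, Real.norm_of_nonneg hNn.le,
        inv_mul_lt_iff₀ hNn]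
      rw [div_lt_iff₀ hr] at hn
      linarith
    obtain ⟨x, hx, y, hy, hxy⟩ := hball hmem
    have hFx := (Set.mem_iInter.1 hx (n + 1)).2 n (Nat.lt_succ_self n)
    have hFy := (Set.mem_iInter.1 hy (n + 1)).2 n (Nat.lt_succ_self n)
    let z : EuclideanSpace ℝ (Fin d) := WithLp.toLp 2 fun i => 1 / 2 - (N : ℝ) ^ n * x i
    have h1 : F z = -F ((N : ℝ) ^ n • x) := hodd _ _ fun i => by simp [z]
    have h2 : F ((N : ℝ) ^ n • y) = F z := hper _ _ fun i => by
      obtain ⟨m, hm⟩ := hqm i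
      refine ⟨m, ?_⟩
      have h3 : x i + y i = p i + ((N : ℝ) ^ n)⁻¹ * q i := by
        simpa using congrArg (fun z : EuclideanSpace ℝ (Fin d) => z i) hxy
      have h4 : (N : ℝ) ^ n * (x i + y i) = (N : ℝ) ^ n * p i + q i := by
        rw [h3, mul_add, mul_inv_cancel_left₀ hNn.ne']
      simp only [z, PiLp.smul_apply, smul_eq_mul]
      linarith
    linarith

/-! ### Necessity of `d ≤ 2 * k`. -/

/-- A `(2,k,d)`-set with `2k < d` contains the face of the cube spanned by the first `k` coordinate
directions. -/
theorem IsTwoSet.mem_of_mem_face {k d : ℕ} {K : Set (EuclideanSpace ℝ (Fin d))}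
    (hK : IsTwoSet k d K) (hkd : 2 * k < d) {p : EuclideanSpace ℝ (Fin d)} (hp : p ∈ unitCube d)
    (hp0 : ∀ i : Fin d, k ≤ i → p i = 0) : p ∈ K := by
  -- The flat through `p` in these directions meets the cube only at `p`: both c ≥ 0 and -∑ c_j ≥ 0
  -- are forced. This uses k + 1 coordinates beyond the first k, hence 2k < d.
  let f : (Fin k → ℝ) →ₗ[ℝ] EuclideanSpace ℝ (Fin d) :=
    { toFun := fun c => WithLp.toLp 2 fun i =>
        if h : k ≤ (i : ℕ) ∧ (i : ℕ) < 2 * k then c ⟨i - k, by omega⟩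
        else if (i : ℕ) = 2 * k then -∑ j, c j else 0
      map_add' := fun a b => by
        ext i
        simp only [PiLp.add_apply, Pi.add_apply, Finset.sum_add_distrib]
        split_ifs <;> simp [add_comm]
      map_smul' := fun a b => by
        ext i
        simp only [PiLp.smul_apply, Pi.smul_apply, smul_eq_mul, RingHom.id_apply, ← Finset.mul_sum]
        split_ifs <;> simp }
  have hf1 : ∀ c (j : Fin k), f c ⟨k + j, by omega⟩ = c j := fun c j => by
    have h : k ≤ k + (j : ℕ) ∧ k + (j : ℕ) < 2 * k := by omega
    change (if h : _ then _ else _) = _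
    rw [dif_pos h]
    congr 1
    ext
    simp
  have hf2 : ∀ c, f c ⟨2 * k, hkd⟩ = -∑ j, c j := fun c => by
    change (if h : _ then _ else _) = _
    rw [dif_neg (by simp), if_pos rfl]
  have hinj : Function.Injective f := fun a b hab => by
    ext j
    rw [← hf1 a j, ← hf1 b j, hab]
  obtain ⟨x, hxV, hxK⟩ := hK.meets_affineSubspace (AffineSubspace.mk' p (LinearMap.range f))
    (by rw [AffineSubspace.direction_mk', LinearMap.finrank_range_of_inj hinj]; simp)
    ⟨p, AffineSubspace.self_mem_mk' _ _, hp⟩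
  obtain ⟨c, hc⟩ := AffineSubspace.mem_mk'.1 hxV
  have hxc : x = p + f c := by rw [hc]; simp
  have hxQ := hK.subset_unitCube hxK
  have hcn : ∀ j, 0 ≤ c j := fun j => by
    have := (hxQ ⟨k + j, by omega⟩).1
    rwa [hxc, PiLp.add_apply, hp0 _ (by simp), hf1, zero_add] at this
  have hcs : ∑ j, c j ≤ 0 := by
    have := (hxQ ⟨2 * k, hkd⟩).1
    rw [hxc, PiLp.add_apply, hp0 _ (by simp; omega), hf2, zero_add] at this
    linarith
  have hc0 : c = 0 := funext fun j =>
    le_antisymm ((Finset.single_le_sum (fun i _ => hcn i) (Finset.mem_univ j)).trans hcs) (hcn j)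
  rw [hc0, map_zero, add_zero] at hxc
  exact hxc ▸ hxK

/-- The flat through `y` parallel to the first k axes meets K. -/
theorem IsTwoSet.exists_mem_eq_coord {k d : ℕ} {K : Set (EuclideanSpace ℝ (Fin d))}
    (hK : IsTwoSet k d K) (hkd : k ≤ d) {y : EuclideanSpace ℝ (Fin d)} (hy : y ∈ unitCube d) :
    ∃ x ∈ K, ∀ i : Fin d, k ≤ i → x i = y i := by
  let f : (Fin k → ℝ) →ₗ[ℝ] EuclideanSpace ℝ (Fin d) :=
    { toFun := fun c => WithLp.toLp 2 fun i => if h : (i : ℕ) < k then c ⟨i, h⟩ else 0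
      map_add' := fun a b => by
        ext i
        simp only [PiLp.add_apply, Pi.add_apply]
        split_ifs <;> simp
      map_smul' := fun a b => by
        ext i
        simp only [PiLp.smul_apply, Pi.smul_apply, smul_eq_mul, RingHom.id_apply]
        split_ifs <;> simp }
  have hf1 : ∀ c (j : Fin k), f c ⟨j, by omega⟩ = c j := fun c j => dif_pos j.2
  have hf2 : ∀ c (i : Fin d), k ≤ (i : ℕ) → f c i = 0 := fun c i hi => dif_neg (not_lt.2 hi)
  have hinj : Function.Injective f := fun a b hab => by
    ext j
    rw [← hf1 a j, ← hf1 b j, hab]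
  obtain ⟨x, hxV, hxK⟩ := hK.meets_affineSubspace (AffineSubspace.mk' y (LinearMap.range f))
    (by rw [AffineSubspace.direction_mk', LinearMap.finrank_range_of_inj hinj]; simp)
    ⟨y, AffineSubspace.self_mem_mk' _ _, hy⟩
  obtain ⟨c, hc⟩ := AffineSubspace.mem_mk'.1 hxV
  have hxc : x = y + f c := by rw [hc]; simp
  exact ⟨x, hxK, fun i hi => by rw [hxc, PiLp.add_apply, hf2 c i hi, add_zero]⟩

theorem IsTwoSet.le_two_mul {k d : ℕ} {K : Set (EuclideanSpace ℝ (Fin d))}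
    (hK : IsTwoSet k d K) : d ≤ 2 * k := by
  by_contra! hkd
  -- `A` consists of the vectors supported on the first `k` coordinates.
  let A : Set (EuclideanSpace ℝ (Fin d)) := {w | ∀ i : Fin d, k ≤ i → w i = 0}
  have hA : IsClosed A := by
    simp only [A, Set.ofPred_forall]
    exact isClosed_iInter fun i => isClosed_iInter fun _ =>
      isClosed_eq (by fun_prop) continuous_const
  -- Halving each coordinate range ensures that, on one piece, the intervals [x_i, x_i + 1] share an
  -- interval of length 1/2.
  let B : (Fin d → Bool) → Set (EuclideanSpace ℝ (Fin d)) := fun σ =>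
    {x | ∀ i, if σ i then 1 / 2 ≤ x i else x i ≤ 1 / 2}
  have hB : ∀ σ, IsClosed (B σ) := fun σ => by
    simp only [B, Set.ofPred_forall]
    refine isClosed_iInter fun i => ?_
    cases σ i
    · simpa using isClosed_le (f := fun x : EuclideanSpace ℝ (Fin d) => x i) (by fun_prop)
        continuous_const
    · simpa using isClosed_le (g := fun x : EuclideanSpace ℝ (Fin d) => x i) continuous_const
        (by fun_prop)
  let T : (Fin d → Bool) → Set (EuclideanSpace ℝ (Fin d)) := fun σ => (K ∩ B σ) + A
  have hT : ∀ σ, IsClosed (T σ) := fun σ => by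
    exact hA.add_left_of_isCompact (hK.isCompact.inter_right (hB σ))
  have hcover : ∀ y ∈ unitCube d, ∃ σ, y ∈ T σ := by
    intro y hy
    obtain ⟨x, hx, hxy⟩ := hK.exists_mem_eq_coord (by omega) hy
    refine ⟨fun i => decide (1 / 2 ≤ x i), x, ⟨hx, fun i => ?_⟩, y - x, fun i hi => ?_,
      add_sub_cancel x y⟩
    · beta_reduce
      by_cases h : 1 / 2 ≤ x i
      · rwa [decide_eq_true h, if_pos rfl]
      · rw [decide_eq_false h, if_neg Bool.false_ne_true]
        exact (not_le.1 h).le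
    · simp [hxy i hi]
  obtain ⟨σ, y, hy⟩ : ∃ σ, (interior (T σ)).Nonempty := by
    by_contra! hcon
    have hdense : Dense (⋂ σ, (T σ)ᶜ) :=
      dense_iInter_of_isOpen (fun σ => (hT σ).isOpen_compl) fun σ =>
        interior_eq_empty_iff_dense_compl.1 (hcon σ)
    have hopen : IsOpen {x : EuclideanSpace ℝ (Fin d) | ∀ i, 0 < x i ∧ x i < 1} := by
      simp only [Set.ofPred_forall, Set.ofPred_and]
      exact isOpen_iInter_of_finite fun i =>
        (isOpen_lt continuous_const (by fun_prop)).inter (isOpen_lt (by fun_prop) continuous_const)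
    obtain ⟨x, hx, hx'⟩ := hdense.inter_open_nonempty _ hopen
      ⟨WithLp.toLp 2 fun _ => 1 / 2, fun i => by norm_num⟩
    obtain ⟨σ, hσ⟩ := hcover x fun i => ⟨(hx i).1.le, (hx i).2.le⟩
    exact Set.mem_iInter.1 hx' σ hσ
  -- Move `y` along `A` to a point near which `K + K` contains everything.
  let q : EuclideanSpace ℝ (Fin d) := WithLp.toLp 2 fun i =>
    if (i : ℕ) < k then (if σ i then 5 / 4 else 3 / 4) else y i
  have hqy : q - y ∈ A := fun i hi => by simp [q, not_lt.2 hi]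
  have hq : T σ ∈ nhds q := by
    have hcont : Filter.Tendsto (fun z => z - (q - y)) (nhds q) (nhds y) := by
      have : Continuous fun z : EuclideanSpace ℝ (Fin d) => z - (q - y) := by fun_prop
      simpa using this.tendsto q
    filter_upwards [hcont (mem_interior_iff_mem_nhds.1 hy)] with z hz
    obtain ⟨x, hx, a, ha, hxa⟩ := hz
    refine ⟨x, hx, a + (q - y), fun i hi => ?_, ?_⟩
    · rw [PiLp.add_apply, ha i hi, hqy i hi, add_zero]
    · have h : x + a = z - (q - y) := hxa
      change x + (a + (q - y)) = z
      rw [← add_assoc, h]; abel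
  have hq' : ∀ᶠ z in nhds q, ∀ i : Fin d, (i : ℕ) < k →
      if σ i then 1 ≤ z i ∧ z i ≤ 3 / 2 else 1 / 2 ≤ z i ∧ z i ≤ 1 := by
    refine Filter.eventually_all.2 fun i => ?_
    by_cases hi : (i : ℕ) < k
    · have hc : Continuous fun z : EuclideanSpace ℝ (Fin d) => z i := by fun_prop
      have hqi : q i = if σ i then 5 / 4 else 3 / 4 := if_pos hi
      cases hσ : σ i
      · have hqi : q i = 3 / 4 := by simp [hqi, hσ]
        filter_upwards [hc.continuousAt.eventually (lt_mem_nhds (show 1 / 2 < q i by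
          rw [hqi]; norm_num)), hc.continuousAt.eventually (gt_mem_nhds (show q i < 1 by
          rw [hqi]; norm_num))] with z h1 h2
        simpa using fun _ => ⟨by simpa using h1.le, h2.le⟩
      · have hqi : q i = 5 / 4 := by simp [hqi, hσ]
        filter_upwards [hc.continuousAt.eventually (lt_mem_nhds (show 1 < q i by
          rw [hqi]; norm_num)), hc.continuousAt.eventually (gt_mem_nhds (show q i < 3 / 2 by
          rw [hqi]; norm_num))] with z h1 h2
        simpa using fun _ => ⟨h1.le, h2.le⟩
    · exact Filter.Eventually.of_forall fun z h => absurd h hi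
  have hKK : K + K ∈ nhds q := by
    filter_upwards [hq, hq'] with z hz hz'
    obtain ⟨x, ⟨hxK, hxB⟩, a, ha, hxa⟩ := hz
    have hxa : x + a = z := hxa
    refine ⟨x, hxK, a, hK.mem_of_mem_face hkd (fun i => ?_) ha, hxa⟩
    by_cases hi : (i : ℕ) < k
    · have h1 : x i + a i = z i := by rw [← hxa, PiLp.add_apply]
      have h2 := hK.subset_unitCube hxK i
      have h3 := hxB i
      have h4 := hz' i hi
      split_ifs at h3 h4 <;> constructor <;> linarith
    · rw [ha i (not_lt.1 hi)]; norm_num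
  have hint := hK.isNowhereDense_add
  have : q ∈ interior (closure (K + K)) :=
    interior_mono subset_closure (mem_interior_iff_mem_nhds.2 hKK)
  rw [hint] at this
  exact this

theorem corollaryc (k d : ℕ) (hd : 2 ≤ d) (hk : k < d) :
    (d : ℝ) / 2 ≤ (k : ℝ) ↔
      ∃ K : Set (EuclideanSpace ℝ (Fin d)), IsTwoSet k d K := by
  have h : (d : ℝ) / 2 ≤ (k : ℝ) ↔ d ≤ 2 * k := by
    rw [div_le_iff₀ two_pos, mul_comm]
    exact_mod_cast Iff.rfl
  rw [h]
  exact ⟨fun h => exists_isTwoSet (by omega) h, fun ⟨_, hK⟩ => hK.le_two_mul⟩
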